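/- Let $n\ge 1$ and let $\langle f\rangle=\int_{\mathbb R^n} f\,dx$ (Lebesgue measure). Let $\Gamma\subseteq[0,\infty)$ be a set of exponents containing at least one positive number (for instance $\Gamma=[0,\infty)$ or $\Gamma=\{\gamma\}$ with $\gamma>0$), and let $\mathcal P$ be the set of probability densities $p$ on $\mathbb R^n$ with $\langle p^{1+\gamma}\rangle<\infty$ for all $\gamma\in\Gamma$. Write $\|p\|_{1+\gamma}=\langle p^{1+\gamma}\rangle^{1/(1+\gamma)}$ and $\log 0=-\infty$. Two functionals $d,\tilde d:\mathcal P\times\mathcal P\to[-\infty,\infty]$ are called equivalent if $\tilde d(q,p)=\xi(d(q,p))$ for all $q,p\in\mathcal P$, where $\xi$ is strictly increasing on the set of values of $d$. A divergence $D(q,p)=d(q,p)-d(q,q)$ is considered through its cross-entropy $d$, up to equivalence. For $\gamma\in\Gamma$ consider the following cross-entropies. * NB-DPD (norm-based Bregman density power divergence). Let $\phi_\gamma:[0,\infty)\to\mathbb R$ $(\gamma\ge0)$ be strictly increasing, convex, and differentiable on $(0,\infty)$, with $\gamma\mapsto\phi_\gamma(1)$ differentiable at $0$ (from the right). Put $$d^{\rm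 NB}_{\phi,\gamma}(q,p)=-\frac{\phi_\gamma(\|p\|_{1+\gamma})-\phi_0(1)}{\gamma}-\frac{\phi_\gamma'(\|p\|_{1+\gamma})\,(\langle qp^\gamma\rangle-\langle p^{1+\gamma}\rangle)}{\gamma\|p\|_{1+\gamma}^{\gamma}}\quad(\gamma>0),$$ and $d^{\rm NB}_{\phi,0}(q,p)=-\phi_0'(1)\langle q\log p\rangle-\partial_\gamma\phi_\gamma(1)|_{\gamma=0}$. * FDPD (functional density power divergence). Let $v:[0,\infty)\to[-\infty,\infty]$ be such that $w(x)=v(e^x)$ is strictly increasing and convex on $\mathbb R\cup\{-\infty\}$. Put $$d^{\rm FDP}_{v,\gamma}(q,p)=-\frac{1+\gamma}{\gamma}v(\langle qp^\gamma\rangle)+\frac1\gamma v(1)+v(\langle p^{1+\gamma}\rangle)\quad(\gamma>0),$$ and $d^{\rm FDP}_{v,0}(q,p)=-v'(1)\langle q\log p\rangle$ (for $v$ differentiable at $1$). * BDPD (bridge density power divergence). For $\lambda_1,\lambda_2\ge0$, not both $0$, put $$d^{\rm BDP}_{\lambda,\gamma}(q,p)=-\frac{1+\gamma}{\lambda_2\gamma}\log(\lambda_1+\lambda_2\langle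 qp^\gamma\rangle)+\frac1{\lambda_2\gamma}\log(\lambda_1+\lambda_2)+\frac1{\lambda_2}\log(\lambda_1+\lambda_2\langle p^{1+\gamma}\rangle)\quad(\gamma>0,\ \lambda_2>0),$$ with, for $\gamma>0$ and $\lambda_2=0$, the limit $\frac1{\lambda_1}\bigl(-\frac{1+\gamma}{\gamma}\langle qp^\gamma\rangle+\frac1\gamma+\langle p^{1+\gamma}\rangle\bigr)$ (a multiple of the density power cross-entropy), and, for $\gamma=0$, $-\frac1{\lambda_1+\lambda_2}\langle q\log p\rangle$. Then the intersection of the NB-DPD class and the FDPD class is exactly the BDPD class: a functional $d:\mathcal P\times\mathcal P\to[-\infty,\infty]$ is equivalent both to some $d^{\rm NB}_{\phi,\gamma}$ with $\gamma\in\Gamma$ and to some $d^{\rm FDP}_{v,\gamma'}$ with $\gamma'\in\Gamma$ if and only if it is equivalent to some $d^{\rm BDP}_{\lambda,\gamma}$ with $\gamma\in\Gamma$. Moreover, for $\gamma\in\Gamma$ with $\gamma>0$ and $v$ as above, $d^{\rm FDP}_{v,\gamma}$ is equivalent to some $d^{\rm NB}_{\phi,\gamma'}$ with $\gamma'\in\Gamma$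 if and only if, on $[0,\infty)$, either $v(z)=az+b$ with $a>0$, $b\in\mathbb R$, or $v(z)=a\log(\lambda_1+\lambda_2z)+b$ with $a>0$, $b\in\mathbb R$, $\lambda_1\ge0$, $\lambda_2>0$. -/

import Mathlib

open MeasureTheory Set
open scoped ENNReal

noncomputable section

namespace PowerDivergence

/-- Probability densities `p` with respect to Lebesgue measure on `ℝⁿ` for which
`⟨p ^ (1 + γ)⟩` is finite for every exponent `γ ∈ Γ`. -/
def densities (n : ℕ) (Γ : Set ℝ) : Set (EuclideanSpace ℝ (Fin n) → ℝ) :=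
  {p | Measurable p ∧ (∀ x, 0 ≤ p x) ∧ Integrable p ∧ ∫ x, p x = 1 ∧
    ∀ γ ∈ Γ, Integrable fun x => p x ^ (1 + γ)}

/-- Functionals `d (q, p)` on pairs of densities; the value `+∞` may occur. -/
abbrev Functional (n : ℕ) (Γ : Set ℝ) : Type :=
  densities n Γ → densities n Γ → EReal

/-- Equivalence of cross-entropies: `d'` is a strictly increasing function of `d`
(strictly increasing on the set of values that `d` takes). -/
def Equivalent {n : ℕ} {Γ : Set ℝ} (d d' : Functional n Γ) : Prop :=
  ∃ ξ : EReal → EReal, StrictMonoOn ξ {t | ∃ q p, d q p = t} ∧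
    ∀ q p, d' q p = ξ (d q p)

section functionals

variable {n : ℕ}

/-- `⟨q p ^ γ⟩`. -/
def cross (γ : ℝ) (q p : EuclideanSpace ℝ (Fin n) → ℝ) : ℝ := ∫ x, q x * p x ^ γ

/-- `⟨p ^ (1 + γ)⟩`. -/
def power (γ : ℝ) (p : EuclideanSpace ℝ (Fin n) → ℝ) : ℝ := ∫ x, p x ^ (1 + γ)

/-- The `L_{1+γ}`-norm of a nonnegative function. -/
def powerNorm (γ : ℝ) (p : EuclideanSpace ℝ (Fin n) → ℝ) : ℝ := power γ p ^ (1 / (1 + γ))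

/-- The Shannon cross-entropy `-⟨q log p⟩`, with `log 0 = -∞` and `0 · (±∞) = 0`: the integral of
the negative part of `q log p` minus the integral of its positive part. -/
def shannon (q p : EuclideanSpace ℝ (Fin n) → ℝ) : EReal :=
  ((∫⁻ x, ENNReal.ofReal (q x) *
      (-ENNReal.log (ENNReal.ofReal (p x))).toENNReal : ℝ≥0∞) : EReal) -
  ((∫⁻ x, ENNReal.ofReal (q x) *
      (ENNReal.log (ENNReal.ofReal (p x))).toENNReal : ℝ≥0∞) : EReal)

/-- The norm-based Bregman density power cross-entropy of the family `φ γ`, `γ ≥ 0`. -/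
def nbCE (φ : ℝ → ℝ → ℝ) (γ : ℝ) (q p : EuclideanSpace ℝ (Fin n) → ℝ) : EReal :=
  if γ = 0 then
    ((deriv (φ 0) 1 : ℝ) : EReal) * shannon q p -
      ((derivWithin (fun g => φ g 1) (Ici 0) 0 : ℝ) : EReal)
  else
    ((-((φ γ (powerNorm γ p) - φ 0 1) / γ) -
      deriv (φ γ) (powerNorm γ p) * (cross γ q p - power γ p) /
        (γ * powerNorm γ p ^ γ) : ℝ) : EReal)

/-- The functional density power cross-entropy of `v`. -/
def fdpCE (v : ℝ → EReal) (γ : ℝ) (q p : EuclideanSpace ℝ (Fin n) → ℝ) : EReal :=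
  if γ = 0 then
    ((deriv (fun z => (v z).toReal) 1 : ℝ) : EReal) * shannon q p
  else
    -((((1 + γ) / γ : ℝ) : EReal) * v (cross γ q p)) +
      ((1 / γ : ℝ) : EReal) * v 1 + v (power γ p)

/-- The density power cross-entropy. -/
def dpCE (γ : ℝ) (q p : EuclideanSpace ℝ (Fin n) → ℝ) : ℝ :=
  -((1 + γ) / γ * cross γ q p) + 1 / γ + power γ p

/-- The extended logarithm of a nonnegative real, `log 0 = -∞`. -/
def elog (z : ℝ) : EReal := ENNReal.log (ENNReal.ofReal z)

/-- The (log-type) bridge density power cross-entropy with parameters `l₁, l₂ ≥ 0`, not both zero.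
For `l₂ = 0` it is its limit as `l₂ → 0`, namely `1 / l₁` times the density power cross-entropy;
for `γ = 0` it is its limit as `γ → 0`, a multiple of the Shannon cross-entropy. -/
def bdpCE (l₁ l₂ γ : ℝ) (q p : EuclideanSpace ℝ (Fin n) → ℝ) : EReal :=
  if γ = 0 then ((1 / (l₁ + l₂) : ℝ) : EReal) * shannon q p
  else if l₂ = 0 then ((1 / l₁ * dpCE γ q p : ℝ) : EReal)
  else
    -((((1 + γ) / (l₂ * γ) : ℝ) : EReal) * elog (l₁ + l₂ * cross γ q p)) +
      ((1 / (l₂ * γ) : ℝ) : EReal) * elog (l₁ + l₂) +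
      ((1 / l₂ : ℝ) : EReal) * elog (l₁ + l₂ * power γ p)

end functionals

/-- The families `φ γ : [0, ∞) → ℝ`, `γ ≥ 0`, that generate norm-based Bregman density power
divergences: strictly increasing, convex, and with the derivatives that the definition uses. -/
structure IsNBGenerator (φ : ℝ → ℝ → ℝ) : Prop where
  strictMono : ∀ γ, 0 ≤ γ → StrictMonoOn (φ γ) (Ici 0)
  convex : ∀ γ, 0 ≤ γ → ConvexOn ℝ (Ici 0) (φ γ)
  differentiable : ∀ γ, 0 ≤ γ → ∀ z, 0 < z → DifferentiableAt ℝ (φ γ) z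
  differentiable_param : DifferentiableWithinAt ℝ (fun γ => φ γ 1) (Ici 0) 0

/-- The functions `v : [0, ∞) → [-∞, ∞]` that generate functional density power divergences:
`w x = v (exp x)` is strictly increasing on `ℝ ∪ {-∞}` and convex. Strict monotonicity makes `v`
finite on `(0, ∞)`, and makes the convexity inequality hold whenever one point is `-∞`. -/
structure IsFDPGenerator (v : ℝ → EReal) : Prop where
  strictMono : StrictMonoOn v (Ici 0)
  convex : ∀ x y s t : ℝ, 0 ≤ s → 0 ≤ t → s + t = 1 →
    v (Real.exp (s * x + t * y)) ≤ (s : EReal) * v (Real.exp x) + (t : EReal) * v (Real.exp y)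

/-- All functionals equivalent to a norm-based Bregman density power cross-entropy with exponent
in `Γ`. -/
def nbClass (n : ℕ) (Γ : Set ℝ) : Set (Functional n Γ) :=
  {d | ∃ γ ∈ Γ, ∃ φ, IsNBGenerator φ ∧ Equivalent (fun q p => nbCE φ γ q.1 p.1) d}

/-- All functionals equivalent to a functional density power cross-entropy with exponent in `Γ`
(for `γ = 0` the definition presupposes that `v` is differentiable at `1`). -/
def fdpClass (n : ℕ) (Γ : Set ℝ) : Set (Functional n Γ) :=
  {d | ∃ γ ∈ Γ, ∃ v, IsFDPGenerator v ∧
    (γ = 0 → DifferentiableAt ℝ (fun z => (v z).toReal) 1) ∧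
    Equivalent (fun q p => fdpCE v γ q.1 p.1) d}

/-- All functionals equivalent to a bridge density power cross-entropy with exponent in `Γ`. -/
def bdpClass (n : ℕ) (Γ : Set ℝ) : Set (Functional n Γ) :=
  {d | ∃ γ ∈ Γ, ∃ l₁ l₂ : ℝ, 0 ≤ l₁ ∧ 0 ≤ l₂ ∧ 0 < l₁ + l₂ ∧
    Equivalent (fun q p => bdpCE l₁ l₂ γ q.1 p.1) d}

end PowerDivergence

end

noncomputable section

namespace PowerDivergence

/-! ### Equivalence as order compatibility -/

section equivalence

variable {n : ℕ} {Γ : Set ℝ} {d d' d'' : Functional n Γ}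

/-! Equivalence only concerns the order of values, so everything is decided by how a cross-entropy
orders pairs `(q, p)`. For a positive exponent both kinds depend on `(q, p)` only through `x = ⟨q p
^ γ⟩` and `y = ⟨p ^ (1 + γ)⟩`, and step densities realize every `x ≥ 0`, `y > 0`
(`exists_cross_power`). The norm-based value is affine and strictly decreasing in `x` for fixed `y`;
the functional value is `-κ v(x) + v(y)` up to a constant, with `κ = (1 + γ) / γ`.

Suppose the two orders agree. Raising `v(y)` by `κ c` is compensated by raising `v(x)` by `c`, and
on the norm-based side the compensating `x'` is an affine function of `x`. So every translate `v +
c`, `c ≥ 0`, is `v` composed with an affine map. These maps form a one-parameter semigroup: either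
translations, which makes `v` affine, or dilations about a point `-l ≤ 0`, which makes `v` a
multiple of `log (l + z)` plus a constant (`affine_or_log_of_affine_shift`). The value at `0` needs
a separate continuity argument (`apply_zero_eq`). Different exponents cannot match, since for
suitable `p` one cross-entropy takes equal values at two densities `q` and the other does not.

Conversely, the two forms of `v` give the bridge cross-entropies up to a positive factor, and
`bridgeGen` gives a norm-based cross-entropy that is a monotone function of them, because its value
is a product whose logarithm splits into an `x` part and a `y` part. For exponent `0` everything is
an increasing affine function of `shannon`. -/

theorem equivalent_iff :
    Equivalent d d' ↔ ∀ q p q' p', d q p < d q' p' ↔ d' q p < d' q' p' := by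
  constructor
  · rintro ⟨ξ, hξ, h⟩ q p q' p'
    rw [h, h, hξ.lt_iff_lt ⟨q, p, rfl⟩ ⟨q', p', rfl⟩]
  · intro h
    classical
    have heq : ∀ q p q' p', d q p = d q' p' → d' q p = d' q' p' := by
      intro q p q' p' e
      apply le_antisymm
      · exact not_lt.1 fun hlt => ((h q' p' q p).2 hlt).ne e.symm
      · exact not_lt.1 fun hlt => ((h q p q' p').2 hlt).ne e
    -- `heq` makes the value independent of the chosen pair; the default `0` lies off the range of
    -- `d`.
    let ξ : EReal → EReal := fun t =>
      if ht : ∃ qp : densities n Γ × densities n Γ, d qp.1 qp.2 = t then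
        d' ht.choose.1 ht.choose.2 else 0
    have hξ : ∀ q p, d' q p = ξ (d q p) := by
      intro q p
      have ht : ∃ qp : densities n Γ × densities n Γ, d qp.1 qp.2 = d q p := ⟨(q, p), rfl⟩
      simp only [ξ, dif_pos ht]
      exact heq _ _ _ _ ht.choose_spec.symm
    refine ⟨ξ, ?_, hξ⟩
    rintro _ ⟨q, p, rfl⟩ _ ⟨q', p', rfl⟩ hlt
    rw [← hξ, ← hξ]
    exact (h _ _ _ _).1 hlt

theorem Equivalent.symm (h : Equivalent d d') : Equivalent d' d :=
  equivalent_iff.2 fun q p q' p' => (equivalent_iff.1 h q p q' p').symm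

theorem Equivalent.trans (h : Equivalent d d') (h' : Equivalent d' d'') : Equivalent d d'' :=
  equivalent_iff.2 fun q p q' p' =>
    (equivalent_iff.1 h q p q' p').trans (equivalent_iff.1 h' q p q' p')

theorem Equivalent.eq_iff_eq (h : Equivalent d d') (q p q' p' : densities n Γ) :
    d q p = d q' p' ↔ d' q p = d' q' p' := by
  have h₁ := equivalent_iff.1 h q p q' p'
  have h₂ := equivalent_iff.1 h q' p' q p
  rw [eq_iff_le_not_lt, eq_iff_le_not_lt, ← not_lt, ← not_lt, h₁, h₂]

end equivalence

/-! ### The functional equation -/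

/-- Cauchy's equation on a half-line: nonnegativity gives monotonicity, which replaces continuity.
Trapping `k * c` between consecutive integers bounds `k` times the error by `f 1` for every `k`. -/
theorem eq_mul_of_additive_nonneg {f : ℝ → ℝ} (hnn : ∀ c, 0 ≤ c → 0 ≤ f c)
    (hadd : ∀ c d, 0 ≤ c → 0 ≤ d → f (c + d) = f c + f d) {c : ℝ} (hc : 0 ≤ c) :
    f c = c * f 1 := by
  have hmono : ∀ a b, 0 ≤ a → a ≤ b → f a ≤ f b := by
    intro a b ha hab
    have := hadd a (b - a) ha (by linarith)
    rw [add_sub_cancel] at this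
    linarith [hnn (b - a) (by linarith)]
  have h0 : f 0 = 0 := by simpa using hadd 0 0 le_rfl le_rfl
  have hnat : ∀ (a : ℝ), 0 ≤ a → ∀ k : ℕ, f (k * a) = k * f a := by
    intro a ha k
    induction k with
    | zero => simp [h0]
    | succ k ih =>
      have := hadd (k * a) a (by positivity) ha
      push_cast
      rw [add_mul, one_mul, this, ih]; ring
  have h1 := hnn 1 zero_le_one
  have key : ∀ k : ℕ, |(f c - c * f 1)| * k ≤ f 1 := by
    intro k
    have hkc : 0 ≤ (k : ℝ) * c := by positivity
    have e1 := hmono _ _ (by positivity) (Nat.floor_le hkc)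
    have e2 := hmono _ _ hkc (Nat.lt_floor_add_one ((k : ℝ) * c)).le
    rw [hnat c hc] at e1 e2
    have e3 := hnat 1 zero_le_one ⌊(k : ℝ) * c⌋₊
    have e4 := hnat 1 zero_le_one (⌊(k : ℝ) * c⌋₊ + 1)
    push_cast at e3 e4
    rw [mul_one] at e3 e4
    rw [e3] at e1
    rw [e4] at e2
    have e5 := mul_le_mul_of_nonneg_right (Nat.floor_le hkc) h1
    have e6 := mul_le_mul_of_nonneg_right (Nat.lt_floor_add_one ((k : ℝ) * c)).le h1
    have hk : (0 : ℝ) ≤ k := by positivity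
    rw [← abs_of_nonneg hk, ← abs_mul, abs_le]
    constructor <;> nlinarith
  by_contra hne
  have hpos : 0 < |f c - c * f 1| := abs_pos.2 (sub_ne_zero.2 hne)
  obtain ⟨k, hk⟩ := exists_nat_gt (f 1 / |f c - c * f 1|)
  rw [div_lt_iff₀ hpos] at hk
  linarith [key k, mul_comm (k : ℝ) |f c - c * f 1|]

/-- A strictly increasing function on `(0, ∞)` all of whose translates `g + c`, `c ≥ 0`, are
obtained by affine substitutions is affine or the logarithm of an affine function. -/
theorem affine_or_log_of_affine_shift {g : ℝ → ℝ} (hg : StrictMonoOn g (Ioi 0))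
    (h : ∀ c, 0 ≤ c → ∃ A B : ℝ, ∀ x, 0 < x → 0 < A * x + B ∧ g (A * x + B) = g x + c) :
    (∃ a b : ℝ, 0 < a ∧ ∀ z, 0 < z → g z = a * z + b) ∨
      ∃ a b l : ℝ, 0 < a ∧ 0 ≤ l ∧ ∀ z, 0 < z → g z = a * Real.log (l + z) + b := by
  have h' : ∀ c, ∃ A B : ℝ, 0 ≤ c → ∀ x, 0 < x → 0 < A * x + B ∧ g (A * x + B) = g x + c := by
    intro c
    by_cases hc : 0 ≤ c
    · obtain ⟨A, B, hAB⟩ := h c hc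
      exact ⟨A, B, fun _ => hAB⟩
    · exact ⟨0, 0, fun hc' => absurd hc' hc⟩
  choose A B hT using h'
  -- The affine maps move points to the right; large `x` then forces `1 ≤ A c`, and small `x` forces
  -- `0 ≤ B c`.
  have hge : ∀ c, 0 ≤ c → ∀ x, 0 < x → x ≤ A c * x + B c := by
    intro c hc x hx
    obtain ⟨h₁, h₂⟩ := hT c hc x hx
    exact (hg.le_iff_le hx h₁).1 (by linarith)
  have hA : ∀ c, 0 ≤ c → 1 ≤ A c := by
    intro c hc
    by_contra! hlt
    have hp : 0 < 1 - A c := by linarith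
    have := hge c hc (|B c| / (1 - A c) + 1) (by positivity)
    have e : (1 - A c) * (|B c| / (1 - A c) + 1) = |B c| + (1 - A c) := by field_simp
    nlinarith [le_abs_self (B c)]
  have hB : ∀ c, 0 ≤ c → 0 ≤ B c := by
    intro c hc
    by_contra! hlt
    have hp := hA c hc
    have hx : 0 < -B c / (2 * A c) := div_pos (by linarith) (by linarith)
    have := hge c hc _ hx
    have e : A c * (-B c / (2 * A c)) = -B c / 2 := by field_simp
    rw [e] at this
    linarith
  -- Semigroup law, by injectivity of `g`: slopes multiply and intercepts satisfy a cocycle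
  -- identity.
  have hcomp : ∀ c d, 0 ≤ c → 0 ≤ d → ∀ x, 0 < x →
      A (c + d) * x + B (c + d) = A c * (A d * x + B d) + B c := by
    intro c d hc hd x hx
    obtain ⟨h₁, h₂⟩ := hT (c + d) (add_nonneg hc hd) x hx
    obtain ⟨h₃, h₄⟩ := hT d hd x hx
    obtain ⟨h₅, h₆⟩ := hT c hc _ h₃
    exact hg.injOn h₁ h₅ (by rw [h₂, h₆, h₄]; ring)
  have hAmul : ∀ c d, 0 ≤ c → 0 ≤ d → A (c + d) = A c * A d := by
    intro c d hc hd
    have e1 := hcomp c d hc hd 1 one_pos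
    have e2 := hcomp c d hc hd 2 two_pos
    linarith
  have hBadd : ∀ c d, 0 ≤ c → 0 ≤ d → B (c + d) = A c * B d + B c := by
    intro c d hc hd
    have e1 := hcomp c d hc hd 1 one_pos
    rw [hAmul c d hc hd] at e1
    linarith
  have hlog : ∀ c, 0 ≤ c → Real.log (A c) = c * Real.log (A 1) := by
    intro c hc
    refine eq_mul_of_additive_nonneg (f := fun c => Real.log (A c))
      (fun c hc => Real.log_nonneg (hA c hc)) (fun c d hc hd => ?_) hc
    have := hA c hc
    have := hA d hd
    rw [hAmul c d hc hd, Real.log_mul (by linarith) (by linarith)]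
  have hgt : 1 < A 1 * 1 + B 1 := by
    obtain ⟨h₁, h₂⟩ := hT 1 zero_le_one 1 one_pos
    exact (hg.lt_iff_lt (mem_Ioi.2 one_pos) h₁).1 (by linarith)
  rcases (hA 1 zero_le_one).eq_or_lt with h1 | h1
  · left
    have hA1 : ∀ c, 0 ≤ c → A c = 1 := by
      intro c hc
      have := hlog c hc
      rw [← h1, Real.log_one, mul_zero] at this
      exact Real.eq_one_of_pos_of_log_eq_zero (by linarith [hA c hc]) this
    have hBlin : ∀ c, 0 ≤ c → B c = c * B 1 := fun c hc =>
      eq_mul_of_additive_nonneg hB (fun c d hc hd => by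
        rw [hBadd c d hc hd, hA1 c hc]; ring) hc
    have hB1 : 0 < B 1 := by rw [← h1] at hgt; linarith
    -- The parameter `c` is the time the semigroup takes to carry `x` to `y`.
    have hshift : ∀ x y, 0 < x → x ≤ y → g y = g x + (y - x) / B 1 := by
      intro x y hx hxy
      have hc : 0 ≤ (y - x) / B 1 := div_nonneg (by linarith) hB1.le
      obtain ⟨-, h₂⟩ := hT _ hc x hx
      rw [hA1 _ hc, hBlin _ hc, div_mul_cancel₀ _ hB1.ne'] at h₂
      rw [← h₂]; congr 1; ring
    refine ⟨1 / B 1, g 1 - 1 / B 1, by positivity, fun z hz => ?_⟩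
    rcases le_total z 1 with hz1 | hz1
    · have := hshift z 1 hz hz1
      rw [this]; field_simp; ring
    · rw [hshift 1 z one_pos hz1]; field_simp; ring
  · right
    set k := Real.log (A 1) with hk
    have hkpos : 0 < k := Real.log_pos h1
    have hAexp : ∀ c, 0 ≤ c → A c = Real.exp (c * k) := by
      intro c hc
      rw [← hlog c hc, Real.exp_log (by linarith [hA c hc])]
    -- The maps commute, so they share the fixed point `-l` of the map for `c = 1`; compare `c + 1`
    -- with `1 + c` in the cocycle identity.
    obtain ⟨l, hl, hBl⟩ : ∃ l, 0 ≤ l ∧ ∀ c, 0 ≤ c → B c = l * (A c - 1) := by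
      refine ⟨B 1 / (A 1 - 1), div_nonneg (hB 1 zero_le_one) (by linarith), fun c hc => ?_⟩
      have e1 := hBadd c 1 hc zero_le_one
      have e2 := hBadd 1 c zero_le_one hc
      rw [add_comm 1 c] at e2
      have : A 1 - 1 ≠ 0 := by linarith
      field_simp
      linarith
    have hshift : ∀ x y, 0 < x → x ≤ y →
        g y = g x + (Real.log (l + y) - Real.log (l + x)) / k := by
      intro x y hx hxy
      have hlx : 0 < l + x := by linarith
      have hly : 0 < l + y := by linarith
      have hc : 0 ≤ (Real.log (l + y) - Real.log (l + x)) / k :=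
        div_nonneg (sub_nonneg.2 (Real.log_le_log hlx (by linarith))) hkpos.le
      obtain ⟨-, h₂⟩ := hT _ hc x hx
      rw [hBl _ hc, hAexp _ hc, div_mul_cancel₀ _ hkpos.ne', Real.exp_sub, Real.exp_log hlx,
        Real.exp_log hly] at h₂
      rw [← h₂]; congr 1; field_simp; ring
    refine ⟨1 / k, g 1 - Real.log (l + 1) / k, l, by positivity, hl, fun z hz => ?_⟩
    rcases le_total z 1 with hz1 | hz1
    · have := hshift z 1 hz hz1
      rw [this]; ring
    · rw [hshift 1 z one_pos hz1]; ring

/-! ### Step densities -/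

/-- The function with the values `a`, `b`, `c` on `A`, `B`, `C` and `0` elsewhere. -/
def stepFn {X : Type*} (A B C : Set X) (a b c : ℝ) : X → ℝ :=
  A.indicator (fun _ => a) + B.indicator (fun _ => b) + C.indicator (fun _ => c)

section stepFn

variable {X : Type*} {A B C : Set X}

theorem stepFn_comp₂ (hAB : Disjoint A B) (hAC : Disjoint A C) (hBC : Disjoint B C)
    {F : ℝ → ℝ → ℝ} (hF : F 0 0 = 0) (a b c a' b' c' : ℝ) :
    (fun x => F (stepFn A B C a b c x) (stepFn A B C a' b' c' x)) =
      stepFn A B C (F a a') (F b b') (F c c') := by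
  funext x
  by_cases hA : x ∈ A
  · have h1 := hAB.notMem_of_mem_left hA
    have h2 := hAC.notMem_of_mem_left hA
    simp [stepFn, hA, h1, h2]
  · by_cases hB : x ∈ B
    · have h2 := hBC.notMem_of_mem_left hB
      simp [stepFn, hA, hB, h2]
    · by_cases hC : x ∈ C <;> simp [stepFn, hA, hB, hC, hF]

theorem stepFn_mem {p : ℝ → Prop} (hAB : Disjoint A B) (hAC : Disjoint A C) (hBC : Disjoint B C)
    {a b c : ℝ} (ha : p a) (hb : p b) (hc : p c) (h0 : p 0) (x : X) :
    p (stepFn A B C a b c x) := by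
  by_cases hA : x ∈ A
  · have h1 := hAB.notMem_of_mem_left hA
    have h2 := hAC.notMem_of_mem_left hA
    simpa [stepFn, hA, h1, h2]
  · by_cases hB : x ∈ B
    · have h2 := hBC.notMem_of_mem_left hB
      simpa [stepFn, hA, hB, h2]
    · by_cases hC : x ∈ C <;> simpa [stepFn, hA, hB, hC]

variable [MeasurableSpace X]

theorem measurable_stepFn (hA : MeasurableSet A) (hB : MeasurableSet B) (hC : MeasurableSet C)
    (a b c : ℝ) : Measurable (stepFn A B C a b c) :=
  ((measurable_const.indicator hA).add (measurable_const.indicator hB)).add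
    (measurable_const.indicator hC)

theorem integrable_stepFn {μ : Measure X} (hA : MeasurableSet A) (hB : MeasurableSet B)
    (hC : MeasurableSet C) (hμA : μ A ≠ ∞) (hμB : μ B ≠ ∞) (hμC : μ C ≠ ∞) (a b c : ℝ) :
    Integrable (stepFn A B C a b c) μ :=
  (((integrableOn_const hμA).integrable_indicator hA).add
    ((integrableOn_const hμB).integrable_indicator hB)).add
    ((integrableOn_const hμC).integrable_indicator hC)

theorem integral_stepFn {μ : Measure X} (hA : MeasurableSet A) (hB : MeasurableSet B)
    (hC : MeasurableSet C) (hμA : μ A ≠ ∞) (hμB : μ B ≠ ∞) (hμC : μ C ≠ ∞) (a b c : ℝ) :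
    ∫ x, stepFn A B C a b c x ∂μ = μ.real A * a + μ.real B * b + μ.real C * c := by
  have iA := (integrableOn_const (C := a) hμA).integrable_indicator hA
  have iB := (integrableOn_const (C := b) hμB).integrable_indicator hB
  have iC := (integrableOn_const (C := c) hμC).integrable_indicator hC
  unfold stepFn
  rw [integral_add' (iA.add iB) iC, integral_add' iA iB, integral_indicator_const _ hA,
    integral_indicator_const _ hB, integral_indicator_const _ hC]
  simp

end stepFn

/-- The box of points with first coordinate in `(s, t]` and the others in `(0, 1]`. -/
def slab {n : ℕ} (i₀ : Fin n) (s t : ℝ) : Set (EuclideanSpace ℝ (Fin n)) :=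
  WithLp.ofLp ⁻¹' univ.pi fun i => if i = i₀ then Ioc s t else Ioc 0 1

section slab

variable {n : ℕ} (i₀ : Fin n)

theorem measurableSet_pi_slab (s t : ℝ) :
    MeasurableSet (univ.pi fun i => if i = i₀ then Ioc s t else Ioc (0 : ℝ) 1) :=
  MeasurableSet.univ_pi fun i => by split_ifs <;> exact measurableSet_Ioc

theorem measurableSet_slab (s t : ℝ) : MeasurableSet (slab i₀ s t) :=
  (PiLp.volume_preserving_ofLp (Fin n)).measurable (measurableSet_pi_slab i₀ s t)

theorem volume_slab (s t : ℝ) : volume (slab i₀ s t) = ENNReal.ofReal (t - s) := by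
  unfold slab
  rw [(PiLp.volume_preserving_ofLp (Fin n)).measure_preimage
    (measurableSet_pi_slab i₀ s t).nullMeasurableSet, volume_pi_pi]
  rw [Finset.prod_eq_single i₀ (fun i _ hi => by simp [hi]) (by simp)]
  simp

theorem disjoint_slab {s t s' t' : ℝ} (h : t ≤ s') : Disjoint (slab i₀ s t) (slab i₀ s' t') := by
  rw [Set.disjoint_left]
  intro x hx hx'
  have h1 := hx i₀ (mem_univ _)
  have h2 := hx' i₀ (mem_univ _)
  simp only [if_true] at h1 h2
  linarith [h1.2, h2.1]

end slab

/-- There is a density with the two positive values `h` and `s` (taken with the probabilities `e`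
and `1 - e`) against which a second density can be placed with arbitrary weights on the two level
sets and off the support. -/
theorem exists_step_density {n : ℕ} (hn : 0 < n) {Γ : Set ℝ} (hΓ : ∀ γ ∈ Γ, 0 ≤ γ)
    {h s e : ℝ} (hh : 0 < h) (hs : 0 < s) (he : 0 < e) (he' : e < 1) :
    ∃ p : densities n Γ, (∀ γ, 0 < γ → power γ p.1 = e * h ^ γ + (1 - e) * s ^ γ) ∧
      ∀ θ η : ℝ, 0 ≤ θ → 0 ≤ η → θ + η ≤ 1 → ∃ q : densities n Γ,
        (∀ γ, 0 < γ → cross γ q.1 p.1 = θ * h ^ γ + η * s ^ γ) ∧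
        (h ≤ 1 → s ≤ 1 → θ + η < 1 → shannon q.1 p.1 = ⊤) := by
  -- The level sets get volumes `e / h` and `(1 - e) / s`. A third block `C` of volume `1`, where
  -- `p` vanishes, takes the remaining mass of `q`.
  have hvA : 0 < e / h := by positivity
  have hvB : 0 < (1 - e) / s := div_pos (by linarith) hs
  set α := e / h with hα
  set β := (1 - e) / s with hβ
  let i₀ : Fin n := ⟨0, hn⟩
  let A := slab i₀ 0 α
  let B := slab i₀ α (α + β)
  let C := slab i₀ (α + β) (α + β + 1)
  have mA : MeasurableSet A := measurableSet_slab _ _ _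
  have mB : MeasurableSet B := measurableSet_slab _ _ _
  have mC : MeasurableSet C := measurableSet_slab _ _ _
  have vA : volume A = ENNReal.ofReal α := by simp [A, volume_slab]
  have vB : volume B = ENNReal.ofReal β := by simp [B, volume_slab]
  have vC : volume C = 1 := by simp [C, volume_slab]
  have fA : volume A ≠ ∞ := by simp [vA]
  have fB : volume B ≠ ∞ := by simp [vB]
  have fC : volume C ≠ ∞ := by simp [vC]
  have rA : volume.real A = α := by simp [Measure.real, vA, hvA.le]
  have rB : volume.real B = β := by simp [Measure.real, vB, hvB.le]
  have rC : volume.real C = 1 := by simp [Measure.real, vC]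
  have dAB : Disjoint A B := disjoint_slab _ le_rfl
  have dAC : Disjoint A C := disjoint_slab _ (by linarith)
  have dBC : Disjoint B C := disjoint_slab _ le_rfl
  have hint : ∀ a b c : ℝ, ∫ x, stepFn A B C a b c x = α * a + β * b + c := by
    intro a b c
    rw [integral_stepFn mA mB mC fA fB fC, rA, rB, rC, one_mul]
  have hmem : ∀ a b c : ℝ, 0 ≤ a → 0 ≤ b → 0 ≤ c → α * a + β * b + c = 1 →
      stepFn A B C a b c ∈ densities n Γ := by
    intro a b c ha hb hc h1
    refine ⟨measurable_stepFn mA mB mC a b c,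
      stepFn_mem (p := fun t => 0 ≤ t) dAB dAC dBC ha hb hc le_rfl,
      integrable_stepFn mA mB mC fA fB fC a b c, by rw [hint, h1], fun γ hγ => ?_⟩
    have h0 : (0 : ℝ) ^ (1 + γ) = 0 := Real.zero_rpow (by linarith [hΓ γ hγ])
    rw [stepFn_comp₂ dAB dAC dBC (F := fun t _ => t ^ (1 + γ)) h0 a b c 0 0 0]
    exact integrable_stepFn mA mB mC fA fB fC _ _ _
  have hαh : α * h = e := by rw [hα]; field_simp
  have hβs : β * s = 1 - e := by rw [hβ]; field_simp
  refine ⟨⟨stepFn A B C h s 0, hmem h s 0 hh.le hs.le le_rfl (by rw [hαh, hβs]; ring)⟩, ?_, ?_⟩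
  · intro γ hγ
    have h0 : (0 : ℝ) ^ (1 + γ) = 0 := Real.zero_rpow (by linarith)
    unfold power
    simp only
    rw [stepFn_comp₂ dAB dAC dBC (F := fun t _ => t ^ (1 + γ)) h0 h s 0 0 0 0, hint, h0,
      Real.rpow_add hh, Real.rpow_add hs, Real.rpow_one, Real.rpow_one, ← hβs, ← hαh]
    ring
  · intro θ η hθ hη hθη
    refine ⟨⟨stepFn A B C (θ / α) (η / β) (1 - θ - η), hmem _ _ _ (by positivity) (by positivity)
      (by linarith) (by field_simp; ring)⟩, ?_, ?_⟩
    · intro γ hγ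
      have h0 : (0 : ℝ) ^ γ = 0 := Real.zero_rpow hγ.ne'
      unfold cross
      simp only
      rw [stepFn_comp₂ dAB dAC dBC (F := fun t u => t * u ^ γ) (by simp), hint, h0]
      field_simp
      ring
    · intro hh1 hs1 hlt
      have hle : ∀ x, stepFn A B C h s 0 x ≤ 1 :=
        stepFn_mem (p := fun t => t ≤ 1) dAB dAC dBC hh1 hs1 zero_le_one zero_le_one
      have hpos : ∫⁻ x, ENNReal.ofReal (stepFn A B C (θ / α) (η / β) (1 - θ - η) x) *
          (ENNReal.log (ENNReal.ofReal (stepFn A B C h s 0 x))).toENNReal = 0 := by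
        rw [← lintegral_zero (μ := volume) (α := EuclideanSpace ℝ (Fin n))]
        refine lintegral_congr fun x => ?_
        rw [EReal.toENNReal_of_nonpos, mul_zero]
        rw [ENNReal.log_le_zero_iff]
        exact ENNReal.ofReal_le_one.2 (hle x)
      -- On `C` the density `q` is positive and `log p = -∞`.
      have hneg : ∫⁻ x, ENNReal.ofReal (stepFn A B C (θ / α) (η / β) (1 - θ - η) x) *
          (-ENNReal.log (ENNReal.ofReal (stepFn A B C h s 0 x))).toENNReal = ⊤ := by
        rw [eq_top_iff]
        calc (⊤ : ℝ≥0∞) = ∫⁻ x, C.indicator (fun _ => ⊤) x := by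
              rw [lintegral_indicator_const mC, vC, mul_one]
          _ ≤ _ := by
              refine lintegral_mono fun x => ?_
              by_cases hx : x ∈ C
              · have h1 := dAC.notMem_of_mem_right hx
                have h2 := dBC.notMem_of_mem_right hx
                have h3 : 0 < 1 - θ - η := by linarith
                simp only [stepFn, Pi.add_apply, indicator_of_mem hx, indicator_of_notMem h1,
                  indicator_of_notMem h2, zero_add, add_zero, ENNReal.ofReal_zero,
                  ENNReal.log_zero, EReal.neg_bot, EReal.toENNReal_top]
                rw [ENNReal.mul_top (ENNReal.ofReal_pos.2 h3).ne']
              · simp [hx]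
      unfold shannon
      simp only
      rw [hpos, hneg]
      simp

/-- Take the first level with `h ^ γ = x + y`, high enough for `q` to reach `x` with mass `x / (x +
y)` there and the rest off the support. The choice of `e` makes this level contribute `y / 2` to the
power term, and `s` is adjusted to supply the other half. -/
theorem exists_cross_power {n : ℕ} (hn : 0 < n) {Γ : Set ℝ} (hΓ : ∀ γ ∈ Γ, 0 ≤ γ) {γ x y : ℝ}
    (hγ : 0 < γ) (hx : 0 ≤ x) (hy : 0 < y) :
    ∃ q p : densities n Γ, cross γ q.1 p.1 = x ∧ power γ p.1 = y := by
  have hxy : 0 < x + y := by linarith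
  set e := y / (2 * (x + y)) with he
  have he0 : 0 < e := by positivity
  have he1 : e < 1 := by rw [he, div_lt_one (by positivity)]; linarith
  have h1e : 0 < 1 - e := by linarith
  have hpow : ∀ t : ℝ, 0 < t → (t ^ (1 / γ)) ^ γ = t := fun t ht => by
    rw [← Real.rpow_mul ht.le, one_div_mul_cancel hγ.ne', Real.rpow_one]
  have hS : 0 < y / 2 / (1 - e) := by positivity
  obtain ⟨p, hp, hq⟩ := exists_step_density hn hΓ (Real.rpow_pos_of_pos hxy (1 / γ))
    (Real.rpow_pos_of_pos hS (1 / γ)) he0 he1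
  obtain ⟨q, hq, -⟩ := hq (x / (x + y)) 0 (by positivity) le_rfl
    (by rw [add_zero, div_le_one hxy]; linarith)
  refine ⟨q, p, ?_, ?_⟩
  · rw [hq γ hγ, hpow _ hxy]; field_simp; ring
  · rw [hp γ hγ, hpow _ hxy, hpow _ hS, mul_div_cancel₀ _ h1e.ne', he]; field_simp; ring

/-- Two densities `q`, `q'` whose cross terms with some `p` agree for one exponent and differ for
another one. -/
theorem exists_cross_eq_cross_ne {n : ℕ} (hn : 0 < n) {Γ : Set ℝ} (hΓ : ∀ γ ∈ Γ, 0 ≤ γ)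
    {γ γ' : ℝ} (hγ : 0 < γ) (hγ' : 0 < γ') (hne : γ ≠ γ') :
    ∃ q q' p : densities n Γ, cross γ q.1 p.1 = cross γ q'.1 p.1 ∧
      cross γ' q.1 p.1 ≠ cross γ' q'.1 p.1 := by
  obtain ⟨p, -, hq⟩ := exists_step_density hn hΓ (h := 1 / 2) (s := 1) (e := 1 / 2)
    (by norm_num) one_pos (by norm_num) (by norm_num)
  -- Full mass on level `1 / 2` and mass `(1 / 2) ^ γ` on level `1` have the same cross term for `γ`
  -- only.
  obtain ⟨q, h₁, -⟩ := hq 1 0 zero_le_one le_rfl (by norm_num)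
  obtain ⟨q', h₂, -⟩ := hq 0 ((1 / 2 : ℝ) ^ γ) le_rfl (by positivity)
    (by rw [zero_add]; exact Real.rpow_le_one (by norm_num) (by norm_num) hγ.le)
  refine ⟨q, q', p, ?_, ?_⟩
  · rw [h₁ γ hγ, h₂ γ hγ]; simp
  · rw [h₁ γ' hγ', h₂ γ' hγ']
    simp only [one_mul, zero_mul, zero_add, add_zero, Real.one_rpow, mul_one]
    exact fun h => hne ((Real.rpow_right_inj (by norm_num) (by norm_num)).1 h).symm

/-- Two densities with different cross terms against some `p`, for which the Shannon cross-entropy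
is infinite. -/
theorem exists_shannon_eq_cross_ne {n : ℕ} (hn : 0 < n) {Γ : Set ℝ} (hΓ : ∀ γ ∈ Γ, 0 ≤ γ) :
    ∃ q q' p : densities n Γ, shannon q.1 p.1 = shannon q'.1 p.1 ∧
      ∀ γ, 0 < γ → cross γ q.1 p.1 ≠ cross γ q'.1 p.1 := by
  obtain ⟨p, -, hq⟩ := exists_step_density hn hΓ (h := 1) (s := 1) (e := 1 / 2)
    one_pos one_pos (by norm_num) (by norm_num)
  obtain ⟨q, h₁, h₁'⟩ := hq 0 0 le_rfl le_rfl (by norm_num)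
  obtain ⟨q', h₂, h₂'⟩ := hq (1 / 2) 0 (by norm_num) le_rfl (by norm_num)
  refine ⟨q, q', p, ?_, fun γ hγ => ?_⟩
  · rw [h₁' le_rfl le_rfl (by norm_num), h₂' le_rfl le_rfl (by norm_num)]
  · rw [h₁ γ hγ, h₂ γ hγ]; simp

theorem cross_nonneg {n : ℕ} {Γ : Set ℝ} (γ : ℝ) (q p : densities n Γ) :
    0 ≤ cross γ q.1 p.1 :=
  integral_nonneg fun x => mul_nonneg (q.2.2.1 x) (Real.rpow_nonneg (p.2.2.1 x) _)

theorem power_pos {n : ℕ} {Γ : Set ℝ} {γ : ℝ} (hγ : γ ∈ Γ) (h0 : 0 ≤ γ) (p : densities n Γ) :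
    0 < power γ p.1 := by
  have hnn : 0 ≤ fun x => p.1 x ^ (1 + γ) := fun x => Real.rpow_nonneg (p.2.2.1 x) _
  refine lt_of_le_of_ne (integral_nonneg hnn) fun h => ?_
  have h1 := (integral_eq_zero_iff_of_nonneg hnn (p.2.2.2.2.2 γ hγ)).1 h.symm
  have h2 : p.1 =ᵐ[volume] fun _ => 0 := by
    filter_upwards [h1] with x hx
    exact (Real.rpow_eq_zero (p.2.2.1 x) (by linarith)).1 hx
  have h3 := p.2.2.2.2.1
  rw [integral_congr_ae h2, integral_zero] at h3
  exact zero_ne_one h3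

/-! ### Norm-based Bregman cross-entropies -/

/-- By convexity the derivative at `z` is at least the secant slope from `0`, which is positive. -/
theorem IsNBGenerator.deriv_pos {φ : ℝ → ℝ → ℝ} (hφ : IsNBGenerator φ) {γ z : ℝ} (hγ : 0 ≤ γ)
    (hz : 0 < z) : 0 < deriv (φ γ) z := by
  have h1 := (hφ.convex γ hγ).slope_le_deriv (x := 0) (y := z) (mem_Ici.2 le_rfl)
    (mem_Ici.2 hz.le) hz (hφ.differentiable γ hγ z hz)
  have h2 := hφ.strictMono γ hγ (mem_Ici.2 le_rfl) (mem_Ici.2 hz.le) hz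
  refine lt_of_lt_of_le ?_ h1
  rw [slope_def_field]
  exact div_pos (by linarith) (by linarith)

/-- The norm-based Bregman cross-entropy is, up to sign, affine in the cross term; this is its slope
as a function of `y = ⟨p ^ (1 + γ)⟩`. -/
def nbSlope (φ : ℝ → ℝ → ℝ) (γ y : ℝ) : ℝ :=
  deriv (φ γ) (y ^ (1 / (1 + γ))) / (γ * (y ^ (1 / (1 + γ))) ^ γ)

/-- The intercept that belongs to `nbSlope`. -/
def nbIntercept (φ : ℝ → ℝ → ℝ) (γ y : ℝ) : ℝ :=
  (φ γ (y ^ (1 / (1 + γ))) - φ 0 1) / γ - nbSlope φ γ y * y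

theorem nbCE_eq {n : ℕ} (φ : ℝ → ℝ → ℝ) {γ : ℝ} (hγ : γ ≠ 0)
    (q p : EuclideanSpace ℝ (Fin n) → ℝ) :
    nbCE φ γ q p =
      ((-(nbSlope φ γ (power γ p) * cross γ q p + nbIntercept φ γ (power γ p)) : ℝ) : EReal) := by
  rw [nbCE, if_neg hγ, nbIntercept, nbSlope, powerNorm]
  congr 1
  ring

theorem IsNBGenerator.nbSlope_pos {φ : ℝ → ℝ → ℝ} (hφ : IsNBGenerator φ) {γ y : ℝ} (hγ : 0 < γ)
    (hy : 0 < y) : 0 < nbSlope φ γ y := by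
  have hN : 0 < y ^ (1 / (1 + γ)) := Real.rpow_pos_of_pos hy _
  exact div_pos (hφ.deriv_pos hγ.le hN) (mul_pos hγ (Real.rpow_pos_of_pos hN _))

/-! ### Functional density power cross-entropies -/

/-- The functional density power cross-entropy as a function of the cross term `x` and the power
term `y`. -/
def fdpVal (v : ℝ → EReal) (γ x y : ℝ) : EReal :=
  -((((1 + γ) / γ : ℝ) : EReal) * v x) + ((1 / γ : ℝ) : EReal) * v 1 + v y

theorem fdpCE_eq {n : ℕ} (v : ℝ → EReal) {γ : ℝ} (hγ : γ ≠ 0)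
    (q p : EuclideanSpace ℝ (Fin n) → ℝ) :
    fdpCE v γ q p = fdpVal v γ (cross γ q p) (power γ p) := by
  rw [fdpCE, if_neg hγ, fdpVal]

theorem elog_of_pos {z : ℝ} (hz : 0 < z) : elog z = (Real.log z : EReal) :=
  ENNReal.log_ofReal_of_pos hz

theorem elog_zero : elog 0 = ⊥ := by simp [elog]

namespace IsFDPGenerator

variable {v : ℝ → EReal}

theorem coe_toReal (hv : IsFDPGenerator v) {z : ℝ} (hz : 0 < z) : ((v z).toReal : EReal) = v z := by
  apply EReal.coe_toReal
  · have := hv.strictMono (mem_Ici.2 hz.le) (mem_Ici.2 (by linarith : (0 : ℝ) ≤ z + 1))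
      (by linarith)
    exact this.ne_top
  · exact (hv.strictMono (mem_Ici.2 le_rfl) (mem_Ici.2 hz.le) hz).ne_bot

theorem strictMonoOn_toReal (hv : IsFDPGenerator v) :
    StrictMonoOn (fun z => (v z).toReal) (Ioi 0) := by
  intro x hx y hy hxy
  have := hv.strictMono (mem_Ici.2 (le_of_lt hx)) (mem_Ici.2 (le_of_lt hy)) hxy
  rwa [← hv.coe_toReal hx, ← hv.coe_toReal hy, EReal.coe_lt_coe_iff] at this

theorem convexOn_toReal_exp (hv : IsFDPGenerator v) :
    ConvexOn ℝ univ fun x => (v (Real.exp x)).toReal := by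
  refine ⟨convex_univ, fun x _ y _ s t hs ht hst => ?_⟩
  have := hv.convex x y s t hs ht hst
  rw [← hv.coe_toReal (Real.exp_pos x), ← hv.coe_toReal (Real.exp_pos y),
    ← hv.coe_toReal (Real.exp_pos _)] at this
  simp only [smul_eq_mul]
  exact_mod_cast this

/-- In the variable `log z`, `v` is convex, hence continuous, and being strictly increasing it grows
at least linearly; the intermediate value theorem applies. -/
theorem exists_toReal_eq (hv : IsFDPGenerator v) {x C : ℝ} (hx : 0 < x)
    (hC : (v x).toReal ≤ C) : ∃ y, x ≤ y ∧ (v y).toReal = C := by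
  set w : ℝ → ℝ := fun t => (v (Real.exp t)).toReal with hw
  have hconv : ConvexOn ℝ univ w := hv.convexOn_toReal_exp
  have hcont : Continuous w := by
    rw [← continuousOn_univ]; exact hconv.continuousOn isOpen_univ
  set a := Real.log x with ha
  have hwa : w a = (v x).toReal := by simp only [hw, ha, Real.exp_log hx]
  have hδ : w a < w (a + 1) := hv.strictMonoOn_toReal (Real.exp_pos _) (Real.exp_pos _)
    (Real.exp_lt_exp.2 (by linarith))
  set δ := w (a + 1) - w a with hδ'
  have hδ0 : 0 < δ := by linarith
  -- The secant over `[a, a + 1]` exceeds `C` at `a + T`; the `+ 1` ensures `T ≥ 1`, so that `a + 1`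
  -- lies between `a` and `a + T`.
  set T := (C - w a) / δ + 1 with hT
  have hT1 : 1 ≤ T := by
    have : 0 ≤ (C - w a) / δ := div_nonneg (by linarith) hδ0.le
    linarith
  have hbig : C ≤ w (a + T) := by
    have hT0 : 0 < T := by linarith
    have h1 : w ((1 - 1 / T) • a + (1 / T) • (a + T)) ≤ (1 - 1 / T) • w a + (1 / T) • w (a + T) :=
      hconv.2 (mem_univ a) (mem_univ (a + T))
        (by rw [sub_nonneg, div_le_one hT0]; exact hT1) (by positivity) (by ring)
    have e : (1 - 1 / T) • a + (1 / T) • (a + T) = a + 1 := by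
      simp only [smul_eq_mul]; field_simp; ring
    rw [e] at h1
    simp only [smul_eq_mul] at h1
    have h2 : T * δ ≤ w (a + T) - w a := by
      have : T * w (a + 1) ≤ T * ((1 - 1 / T) * w a + 1 / T * w (a + T)) :=
        mul_le_mul_of_nonneg_left h1 hT0.le
      have e2 : T * ((1 - 1 / T) * w a + 1 / T * w (a + T)) = T * w a - w a + w (a + T) := by
        field_simp
      rw [hδ']
      linarith
    have h3 : T * δ = C - w a + δ := by rw [hT]; field_simp
    linarith
  obtain ⟨t, ht, hwt⟩ := intermediate_value_Icc (by linarith : a ≤ a + T) hcont.continuousOn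
    ⟨hwa ▸ hC, hbig⟩
  refine ⟨Real.exp t, ?_, hwt⟩
  rw [← Real.exp_log hx]
  exact Real.exp_le_exp.2 ht.1

theorem fdpVal_eq (hv : IsFDPGenerator v) {γ x y : ℝ} (hx : 0 < x) (hy : 0 < y) :
    fdpVal v γ x y = ((-((1 + γ) / γ * (v x).toReal) + 1 / γ * (v 1).toReal +
      (v y).toReal : ℝ) : EReal) := by
  rw [fdpVal, ← hv.coe_toReal hx, ← hv.coe_toReal hy, ← hv.coe_toReal one_pos]
  simp only [EReal.toReal_coe]
  norm_cast

theorem fdpVal_lt (hv : IsFDPGenerator v) {γ x x' y : ℝ} (hγ : 0 < γ) (hx : 0 ≤ x) (hxx' : x < x')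
    (hy : 0 < y) : fdpVal v γ x' y < fdpVal v γ x y := by
  have hlt := hv.strictMono (mem_Ici.2 hx) (mem_Ici.2 (hx.trans hxx'.le)) hxx'
  have hκ : 0 < (1 + γ) / γ := by positivity
  rw [hv.fdpVal_eq (hx.trans_lt hxx') hy]
  rw [← hv.coe_toReal (hx.trans_lt hxx')] at hlt
  rw [fdpVal, ← hv.coe_toReal hy, ← hv.coe_toReal one_pos]
  generalize v x = u at hlt
  induction u with
  | bot =>
    rw [EReal.coe_mul_bot_of_pos hκ, EReal.neg_bot, ← EReal.coe_mul, EReal.top_add_coe,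
      EReal.top_add_coe]
    exact EReal.coe_lt_top _
  | top => exact absurd hlt (not_lt.2 le_top)
  | coe r =>
    rw [EReal.coe_lt_coe_iff] at hlt
    simp only [EReal.toReal_coe]
    norm_cast
    have := mul_lt_mul_of_pos_left hlt hκ
    linarith

theorem fdpVal_ne (hv : IsFDPGenerator v) {γ x x' y : ℝ} (hγ : 0 < γ) (hx : 0 ≤ x) (hx' : 0 ≤ x')
    (hne : x ≠ x') (hy : 0 < y) : fdpVal v γ x y ≠ fdpVal v γ x' y := by
  rcases hne.lt_or_gt with h | h
  · exact (hv.fdpVal_lt hγ hx h hy).ne'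
  · exact (hv.fdpVal_lt hγ hx' h hy).ne

/-- If the functional density power cross-entropy of `v` orders the pairs `(x, y)` like a
functional that is affine and decreasing in `x`, then `v` does not jump at `0`. -/
theorem apply_zero_eq (hv : IsFDPGenerator v) {γ : ℝ} (hγ : 0 < γ) {α β : ℝ → ℝ}
    (h : ∀ x x' y y', 0 ≤ x → 0 ≤ x' → 0 < y → 0 < y' →
      (-(α y * x + β y) < -(α y' * x' + β y') ↔ fdpVal v γ x y < fdpVal v γ x' y'))
    {g : ℝ → ℝ} (hg : ContinuousAt g 0) (hgv : ∀ z, 0 < z → v z = g z) : v 0 = g 0 := by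
  have hgt : ∀ᶠ z in nhdsWithin (0 : ℝ) (Ioi 0), 0 < z := self_mem_nhdsWithin
  have hlim : Filter.Tendsto g (nhdsWithin 0 (Ioi 0)) (nhds (g 0)) :=
    hg.tendsto.mono_left inf_le_left
  have hle : v 0 ≤ g 0 := by
    refine ge_of_tendsto ((continuous_coe_real_ereal.tendsto _).comp hlim) ?_
    filter_upwards [hgt] with z hz
    rw [Function.comp_apply, ← hgv z hz]
    exact (hv.strictMono (mem_Ici.2 le_rfl) (mem_Ici.2 hz.le) hz).le
  have hgmono : ∀ z z', 0 < z → z < z' → g z < g z' := by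
    intro z z' hz hzz'
    have := hv.strictMono (mem_Ici.2 hz.le) (mem_Ici.2 (hz.trans hzz').le) hzz'
    rwa [hgv z hz, hgv z' (hz.trans hzz'), EReal.coe_lt_coe_iff] at this
  have hg0 : ∀ z, 0 < z → g 0 < g z := by
    intro z hz
    refine lt_of_le_of_lt ?_ (hgmono (z / 2) z (by linarith) (by linarith))
    refine le_of_tendsto hlim ?_
    filter_upwards [hgt, nhdsWithin_le_nhds (Iio_mem_nhds (half_pos hz))] with t ht ht'
    exact (hgmono t (z / 2) ht ht').le
  by_contra hne
  have hlt : v 0 < g 0 := lt_of_le_of_ne hle hne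
  have hκ : 0 < (1 + γ) / γ := by positivity
  have hr : ∀ z, 0 < z → (v z).toReal = g z := fun z hz => by rw [hgv z hz, EReal.toReal_coe]
  -- With this `Y` the value at `(1, Y)` is the limit of the values at `(x, 1)` as `x → 0+`. A jump
  -- of `v` would put it strictly below the value at `(0, 1)`, which the affine side, continuous in
  -- `x`, excludes.
  obtain ⟨Y, hY1, hY⟩ := hv.exists_toReal_eq (x := 1) (C := g 1 + (1 + γ) / γ * (g 1 - g 0))
    one_pos (by
      rw [hr 1 one_pos]
      have := mul_pos hκ (sub_pos.2 (hg0 1 one_pos))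
      linarith)
  have hY0 : 0 < Y := by linarith
  have hbelow : ∀ x, 0 < x → -(α 1 * x + β 1) < -(α Y * 1 + β Y) := by
    intro x hx
    rw [h x 1 1 Y hx.le zero_le_one one_pos hY0, hv.fdpVal_eq hx one_pos,
      hv.fdpVal_eq one_pos hY0, EReal.coe_lt_coe_iff, hr x hx, hr 1 one_pos, hY]
    have := mul_lt_mul_of_pos_left (hg0 x hx) hκ
    linarith
  have habove : -(α Y * 1 + β Y) < -(α 1 * 0 + β 1) := by
    rw [h 1 0 Y 1 zero_le_one le_rfl hY0 one_pos, hv.fdpVal_eq one_pos hY0, fdpVal, hr 1 one_pos,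
      hY, hgv 1 one_pos]
    generalize v 0 = u at hlt
    induction u with
    | bot =>
      rw [EReal.coe_mul_bot_of_pos hκ, EReal.neg_bot, ← EReal.coe_mul, EReal.top_add_coe,
        EReal.top_add_coe]
      exact EReal.coe_lt_top _
    | top => exact absurd hlt (not_lt.2 le_top)
    | coe r =>
      rw [EReal.coe_lt_coe_iff] at hlt
      norm_cast
      have := mul_lt_mul_of_pos_left hlt hκ
      linarith
  have hcont : Filter.Tendsto (fun x => -(α 1 * x + β 1)) (nhdsWithin 0 (Ioi 0))
      (nhds (-(α 1 * 0 + β 1))) :=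
    (Continuous.tendsto (by fun_prop) 0).mono_left inf_le_left
  refine absurd habove (not_lt.2 (le_of_tendsto hcont ?_))
  filter_upwards [hgt] with x hx
  exact (hbelow x hx).le

/-- If the functional density power cross-entropy of `v` orders the pairs `(x, y)` like a
functional that is affine and decreasing in `x`, then `v` is affine or the logarithm of an affine
function. -/
theorem affine_or_log (hv : IsFDPGenerator v) {γ : ℝ} (hγ : 0 < γ) {α β : ℝ → ℝ}
    (hα : ∀ y, 0 < y → 0 < α y)
    (h : ∀ x x' y y', 0 ≤ x → 0 ≤ x' → 0 < y → 0 < y' →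
      (-(α y * x + β y) < -(α y' * x' + β y') ↔ fdpVal v γ x y < fdpVal v γ x' y')) :
    (∃ a b : ℝ, 0 < a ∧ ∀ z : ℝ, 0 ≤ z → v z = ((a * z + b : ℝ) : EReal)) ∨
      ∃ a b l₁ l₂ : ℝ, 0 < a ∧ 0 ≤ l₁ ∧ 0 < l₂ ∧
        ∀ z : ℝ, 0 ≤ z → v z = (a : EReal) * elog (l₁ + l₂ * z) + (b : EReal) := by
  have hκ : 0 < (1 + γ) / γ := by positivity
  -- Solve `v Y = v 1 + κ c` and `v x' = v x + c`: then `(x, 1)` and `(x', Y)` lie on one level set,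
  -- whose affine description expresses `x'` through `x`.
  have hshift : ∀ c, 0 ≤ c → ∃ A B : ℝ, ∀ x, 0 < x →
      0 < A * x + B ∧ (v (A * x + B)).toReal = (v x).toReal + c := by
    intro c hc
    obtain ⟨Y, hY1, hY⟩ := hv.exists_toReal_eq (x := 1) (C := (v 1).toReal + (1 + γ) / γ * c)
      one_pos (by linarith [mul_nonneg hκ.le hc])
    have hY0 : 0 < Y := by linarith
    have hαY := hα Y hY0
    refine ⟨α 1 / α Y, (β 1 - β Y) / α Y, fun x hx => ?_⟩
    obtain ⟨x', hxx', hx'⟩ := hv.exists_toReal_eq (x := x) (C := (v x).toReal + c) hx (by linarith)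
    have hx'0 : 0 < x' := by linarith
    have hval : fdpVal v γ x 1 = fdpVal v γ x' Y := by
      rw [hv.fdpVal_eq hx one_pos, hv.fdpVal_eq hx'0 hY0, hx', hY]
      congr 1; ring
    have h1 := (h x x' 1 Y hx.le hx'0.le one_pos hY0).not.2 hval.not_lt
    have h2 := (h x' x Y 1 hx'0.le hx.le hY0 one_pos).not.2 hval.not_gt
    have heq : α 1 / α Y * x + (β 1 - β Y) / α Y = x' := by
      field_simp
      linarith
    rw [heq]
    exact ⟨hx'0, hx'⟩
  rcases affine_or_log_of_affine_shift hv.strictMonoOn_toReal hshift with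
    ⟨a, b, ha, hab⟩ | ⟨a, b, l, ha, hl, hab⟩
  · left
    have hpos : ∀ z, 0 < z → v z = ((a * z + b : ℝ) : EReal) := fun z hz => by
      rw [← hv.coe_toReal hz, hab z hz]
    refine ⟨a, b, ha, fun z hz => ?_⟩
    rcases hz.eq_or_lt with rfl | hz
    · exact hv.apply_zero_eq hγ h (g := fun z => a * z + b) (by fun_prop) hpos
    · exact hpos z hz
  · right
    have hpos : ∀ z, 0 < z → v z = ((a * Real.log (l + z) + b : ℝ) : EReal) := fun z hz => by
      rw [← hv.coe_toReal hz, hab z hz]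
    refine ⟨a, b, l, 1, ha, hl, one_pos, fun z hz => ?_⟩
    rw [one_mul]
    rcases hz.eq_or_lt with rfl | hz
    · rcases hl.eq_or_lt with rfl | hl
      -- For `l = 0` monotonicity alone gives `v 0 = -∞`, as `v` is unbounded below near `0`.
      · rw [add_zero, elog_zero, EReal.coe_mul_bot_of_pos ha, EReal.bot_add,
          EReal.eq_bot_iff_forall_lt]
        intro r
        have hz := Real.exp_pos ((r - b) / a)
        refine (hv.strictMono (mem_Ici.2 le_rfl) (mem_Ici.2 hz.le) hz).trans_le ?_
        rw [hpos _ hz, zero_add, Real.log_exp, mul_div_cancel₀ _ ha.ne']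
        simp
      · rw [add_zero, elog_of_pos hl]
        have hc : ContinuousAt (fun z => a * Real.log (l + z) + b) 0 := by
          have : l + 0 ≠ 0 := by linarith
          fun_prop (disch := assumption)
        rw [hv.apply_zero_eq hγ h hc hpos, add_zero]
        norm_cast
    · rw [hpos z hz, elog_of_pos (by linarith)]
      norm_cast

end IsFDPGenerator

/-! ### Coincidence of exponents -/

section classes

variable {n : ℕ} {Γ : Set ℝ}

/-- A functional density power cross-entropy with positive exponent that is equivalent to a
norm-based Bregman one has a generator that is affine or the logarithm of an affine function. -/
theorem generator_of_mem_nbClass (hn : 0 < n) (hΓ : ∀ γ ∈ Γ, 0 ≤ γ) {γ : ℝ} (hγΓ : γ ∈ Γ)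
    (hγ : 0 < γ) {v : ℝ → EReal} (hv : IsFDPGenerator v)
    (h : (fun q p => fdpCE v γ q.1 p.1) ∈ nbClass n Γ) :
    (∃ a b : ℝ, 0 < a ∧ ∀ z : ℝ, 0 ≤ z → v z = ((a * z + b : ℝ) : EReal)) ∨
      ∃ a b l₁ l₂ : ℝ, 0 < a ∧ 0 ≤ l₁ ∧ 0 < l₂ ∧
        ∀ z : ℝ, 0 ≤ z → v z = (a : EReal) * elog (l₁ + l₂ * z) + (b : EReal) := by
  obtain ⟨γ', hγ'Γ, φ, hφ, hE⟩ := h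
  rcases (hΓ γ' hγ'Γ).eq_or_lt with h0 | hγ'
  · obtain ⟨q, q', p, hs, hc⟩ := exists_shannon_eq_cross_ne hn hΓ
    have := (hE.eq_iff_eq q p q' p).1 (by simp only [nbCE, ← h0, if_true, hs])
    simp only [fdpCE_eq v hγ.ne'] at this
    exact absurd this (hv.fdpVal_ne hγ (cross_nonneg _ _ _) (cross_nonneg _ _ _) (hc γ hγ)
      (power_pos hγΓ hγ.le p))
  · by_cases hne : γ' = γ
    · subst hne
      refine hv.affine_or_log hγ (fun y hy => hφ.nbSlope_pos hγ hy)
        (β := nbIntercept φ γ') fun x x' y y' hx hx' hy hy' => ?_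
      obtain ⟨q, p, rfl, rfl⟩ := exists_cross_power hn hΓ hγ hx hy
      obtain ⟨q', p', rfl, rfl⟩ := exists_cross_power hn hΓ hγ hx' hy'
      have := equivalent_iff.1 hE q p q' p'
      simpa only [nbCE_eq φ hγ.ne', fdpCE_eq v hγ.ne', EReal.coe_lt_coe_iff] using this
    · obtain ⟨q, q', p, he, hc⟩ := exists_cross_eq_cross_ne hn hΓ hγ' hγ hne
      have := (hE.eq_iff_eq q p q' p).1 (by simp only [nbCE_eq φ hγ'.ne', he])
      simp only [fdpCE_eq v hγ.ne'] at this
      exact absurd this (hv.fdpVal_ne hγ (cross_nonneg _ _ _) (cross_nonneg _ _ _) hc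
        (power_pos hγΓ hγ.le p))

/-- A norm-based Bregman cross-entropy with positive exponent is not a function of the Shannon
cross-entropy. -/
theorem exists_shannon_eq_nbCE_ne (hn : 0 < n) (hΓ : ∀ γ ∈ Γ, 0 ≤ γ) {γ : ℝ} (hγΓ : γ ∈ Γ)
    (hγ : 0 < γ) {φ : ℝ → ℝ → ℝ} (hφ : IsNBGenerator φ) :
    ∃ q q' p : densities n Γ, shannon q.1 p.1 = shannon q'.1 p.1 ∧
      nbCE φ γ q.1 p.1 ≠ nbCE φ γ q'.1 p.1 := by
  obtain ⟨q, q', p, hs, hc⟩ := exists_shannon_eq_cross_ne hn hΓ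
  refine ⟨q, q', p, hs, fun h => hc γ hγ ?_⟩
  rw [nbCE_eq φ hγ.ne', nbCE_eq φ hγ.ne', EReal.coe_eq_coe_iff, neg_inj, add_left_inj] at h
  exact mul_left_cancel₀ (hφ.nbSlope_pos hγ (power_pos hγΓ hγ.le p)).ne' h

/-! ### Shannon cross-entropies -/

theorem coe_mul_lt_coe_mul_iff {a : ℝ} (ha : 0 < a) {x y : EReal} :
    (a : EReal) * x < a * y ↔ x < y := by
  have hinv : ∀ z : EReal, ((a⁻¹ : ℝ) : EReal) * (a * z) = z := fun z => by
    rw [← mul_assoc, ← EReal.coe_mul, inv_mul_cancel₀ ha.ne', EReal.coe_one, one_mul]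
  have hmono : ∀ {b : ℝ}, 0 < b → Monotone fun z : EReal => (b : EReal) * z :=
    fun hb _ _ hxy => mul_le_mul_of_nonneg_left hxy (by exact_mod_cast hb.le)
  rw [← not_le, ← not_le, not_iff_not]
  refine ⟨fun h => ?_, fun h => hmono ha h⟩
  simpa only [hinv] using hmono (inv_pos.2 ha) h

theorem sub_coe_lt_sub_coe_iff {b : ℝ} {x y : EReal} : x - (b : EReal) < y - b ↔ x < y := by
  induction x <;> induction y <;> simp [← EReal.coe_sub]

theorem nbCE_zero_lt_iff {φ : ℝ → ℝ → ℝ} (hφ : IsNBGenerator φ)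
    {q p q' p' : EuclideanSpace ℝ (Fin n) → ℝ} :
    nbCE φ 0 q p < nbCE φ 0 q' p' ↔ shannon q p < shannon q' p' := by
  rw [nbCE, nbCE, if_pos rfl, if_pos rfl, sub_coe_lt_sub_coe_iff,
    coe_mul_lt_coe_mul_iff (hφ.deriv_pos le_rfl one_pos)]

theorem bdpCE_zero_lt_iff {l₁ l₂ : ℝ} (hl : 0 < l₁ + l₂)
    {q p q' p' : EuclideanSpace ℝ (Fin n) → ℝ} :
    bdpCE l₁ l₂ 0 q p < bdpCE l₁ l₂ 0 q' p' ↔ shannon q p < shannon q' p' := by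
  rw [bdpCE, bdpCE, if_pos rfl, if_pos rfl, coe_mul_lt_coe_mul_iff (by positivity)]

/-! ### Bridge cross-entropies as functional density power cross-entropies -/

theorem isFDPGenerator_coe : IsFDPGenerator fun z => (z : EReal) where
  strictMono := fun _ _ _ _ h => EReal.coe_lt_coe_iff.2 h
  convex := fun x y s t hs ht hst => by
    have := convexOn_exp.2 (mem_univ x) (mem_univ y) hs ht hst
    simp only [smul_eq_mul] at this
    exact_mod_cast this

/-- Convexity of log-sum-exp, that is, Hölder's inequality for two terms: apply weighted AM-GM to
the two summands, each divided by its total, and add. -/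
theorem isFDPGenerator_elog {l₁ l₂ : ℝ} (h₁ : 0 ≤ l₁) (h₂ : 0 < l₂) :
    IsFDPGenerator fun z => elog (l₁ + l₂ * z) where
  strictMono := fun x hx y _ h => by
    have hx : 0 ≤ x := hx
    refine ENNReal.log_strictMono ((ENNReal.ofReal_lt_ofReal_iff ?_).2 ?_)
    · have : 0 < l₂ * y := mul_pos h₂ (hx.trans_lt h)
      linarith
    · linarith [mul_lt_mul_of_pos_left h h₂]
  convex := fun x y s t hs ht hst => by
    have hpos : ∀ u, 0 < l₁ + l₂ * Real.exp u := fun u => by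
      have := mul_pos h₂ (Real.exp_pos u)
      linarith
    rw [elog_of_pos (hpos _), elog_of_pos (hpos _), elog_of_pos (hpos _)]
    norm_cast
    set P := l₁ + l₂ * Real.exp x with hP
    set Q := l₁ + l₂ * Real.exp y with hQ
    have hP0 : 0 < P := hpos x
    have hQ0 : 0 < Q := hpos y
    have hsum : s * Real.log P + t * Real.log Q = Real.log (P ^ s * Q ^ t) := by
      rw [Real.log_mul (by positivity) (by positivity), Real.log_rpow hP0, Real.log_rpow hQ0]
    rw [hsum]
    refine Real.log_le_log (hpos _) ?_
    have ex := (Real.exp_pos x).le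
    have ey := (Real.exp_pos y).le
    have g1 := Real.geom_mean_le_arith_mean2_weighted hs ht (div_nonneg h₁ hP0.le)
      (div_nonneg h₁ hQ0.le) hst
    have g2 := Real.geom_mean_le_arith_mean2_weighted hs ht
      (div_nonneg (mul_nonneg h₂.le ex) hP0.le) (div_nonneg (mul_nonneg h₂.le ey) hQ0.le) hst
    have hpow : ∀ {c : ℝ}, 0 ≤ c → c ^ s * c ^ t = c := fun {c} hc => by
      rw [← Real.rpow_add_of_nonneg hc hs ht, hst, Real.rpow_one]
    rw [Real.div_rpow h₁ hP0.le, Real.div_rpow h₁ hQ0.le, div_mul_div_comm, hpow h₁] at g1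
    have he : (l₂ * Real.exp x) ^ s * (l₂ * Real.exp y) ^ t = l₂ * Real.exp (s * x + t * y) := by
      rw [Real.mul_rpow h₂.le ex, Real.mul_rpow h₂.le ey, mul_mul_mul_comm, hpow h₂.le,
        Real.exp_add, mul_comm s x, mul_comm t y, Real.exp_mul, Real.exp_mul]
    rw [Real.div_rpow (mul_nonneg h₂.le ex) hP0.le, Real.div_rpow (mul_nonneg h₂.le ey) hQ0.le,
      div_mul_div_comm, he] at g2
    have hone : s * (l₁ / P) + t * (l₁ / Q) +
        (s * (l₂ * Real.exp x / P) + t * (l₂ * Real.exp y / Q)) = 1 := by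
      have e1 : l₁ / P + l₂ * Real.exp x / P = 1 := by rw [← add_div, ← hP, div_self hP0.ne']
      have e2 : l₁ / Q + l₂ * Real.exp y / Q = 1 := by rw [← add_div, ← hQ, div_self hQ0.ne']
      linear_combination s * e1 + t * e2 + hst
    have hfin := (add_le_add g1 g2).trans_eq hone
    rwa [← add_div, div_le_one (by positivity)] at hfin

/-- The constant `b` drops out because the coefficients `-(1 + γ) / γ`, `1 / γ` and `1` add up to
`0`. -/
theorem equivalent_fdpCE_bdpCE_affine {γ : ℝ} (hγ : 0 < γ) (hγΓ : γ ∈ Γ) {v : ℝ → EReal}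
    {a b l : ℝ} (ha : 0 < a) (hl : 0 < l)
    (hv : ∀ z : ℝ, 0 ≤ z → v z = ((a * z + b : ℝ) : EReal)) :
    Equivalent (n := n) (Γ := Γ) (fun q p => fdpCE v γ q.1 p.1)
      (fun q p => bdpCE l 0 γ q.1 p.1) := by
  have hE : ∀ q p : densities n Γ, fdpCE v γ q.1 p.1 = ((a * dpCE γ q.1 p.1 : ℝ) : EReal) := by
    intro q p
    rw [fdpCE_eq v hγ.ne', fdpVal, hv _ (cross_nonneg _ _ _), hv 1 zero_le_one,
      hv _ (power_pos hγΓ hγ.le p).le]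
    norm_cast
    rw [dpCE]
    field_simp
    ring
  refine equivalent_iff.2 fun q p q' p' => ?_
  simp only [hE, bdpCE, hγ.ne', if_false, if_true, EReal.coe_lt_coe_iff]
  rw [mul_lt_mul_iff_right₀ ha, mul_lt_mul_iff_right₀ (by positivity)]

theorem bdpCE_eq_top {γ l₁ l₂ : ℝ} (hγΓ : γ ∈ Γ) (hγ : 0 < γ) (h₁ : 0 ≤ l₁) (h₂ : 0 < l₂)
    {q p : densities n Γ} (h : l₁ + l₂ * cross γ q.1 p.1 = 0) :
    bdpCE l₁ l₂ γ q.1 p.1 = ⊤ := by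
  have hy := mul_pos h₂ (power_pos hγΓ hγ.le p)
  rw [bdpCE, if_neg hγ.ne', if_neg h₂.ne', h, elog_zero, elog_of_pos (by linarith),
    elog_of_pos (by linarith), EReal.coe_mul_bot_of_pos (by positivity), EReal.neg_bot,
    ← EReal.coe_mul, ← EReal.coe_mul, EReal.top_add_coe, EReal.top_add_coe]

theorem bdpCE_eq_coe {γ l₁ l₂ : ℝ} (hγΓ : γ ∈ Γ) (hγ : 0 < γ) (h₁ : 0 ≤ l₁) (h₂ : 0 < l₂)
    {q p : densities n Γ} (h : 0 < l₁ + l₂ * cross γ q.1 p.1) :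
    bdpCE l₁ l₂ γ q.1 p.1 =
      ((-((1 + γ) / (l₂ * γ) * Real.log (l₁ + l₂ * cross γ q.1 p.1)) +
        1 / (l₂ * γ) * Real.log (l₁ + l₂) +
        1 / l₂ * Real.log (l₁ + l₂ * power γ p.1) : ℝ) : EReal) := by
  have hy := mul_pos h₂ (power_pos hγΓ hγ.le p)
  rw [bdpCE, if_neg hγ.ne', if_neg h₂.ne', elog_of_pos h, elog_of_pos (by linarith),
    elog_of_pos (by linarith)]
  norm_cast

theorem equivalent_fdpCE_bdpCE_log {γ : ℝ} (hγ : 0 < γ) (hγΓ : γ ∈ Γ) {v : ℝ → EReal}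
    {a b l₁ l₂ : ℝ} (ha : 0 < a) (h₁ : 0 ≤ l₁) (h₂ : 0 < l₂)
    (hv : ∀ z : ℝ, 0 ≤ z → v z = (a : EReal) * elog (l₁ + l₂ * z) + (b : EReal)) :
    Equivalent (n := n) (Γ := Γ) (fun q p => fdpCE v γ q.1 p.1)
      (fun q p => bdpCE l₁ l₂ γ q.1 p.1) := by
  have hE : ∀ q p : densities n Γ,
      fdpCE v γ q.1 p.1 = ((a * l₂ : ℝ) : EReal) * bdpCE l₁ l₂ γ q.1 p.1 := by
    intro q p
    have hx := mul_nonneg h₂.le (cross_nonneg γ q p)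
    have hy := mul_pos h₂ (power_pos hγΓ hγ.le p)
    rw [fdpCE_eq v hγ.ne', fdpVal, hv _ (cross_nonneg _ _ _), hv 1 zero_le_one,
      hv _ (power_pos hγΓ hγ.le p).le, mul_one, elog_of_pos (by linarith : 0 < l₁ + l₂),
      elog_of_pos (by linarith : 0 < l₁ + l₂ * power γ p.1)]
    rcases (add_nonneg h₁ hx).eq_or_lt with h0 | h0
    · rw [bdpCE_eq_top hγΓ hγ h₁ h₂ h0.symm, ← h0, elog_zero, EReal.coe_mul_bot_of_pos ha,
        EReal.bot_add, EReal.coe_mul_bot_of_pos (by positivity), EReal.neg_bot,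
        EReal.coe_mul_top_of_pos (by positivity)]
      norm_cast
    · rw [bdpCE_eq_coe hγΓ hγ h₁ h₂ h0, elog_of_pos h0]
      norm_cast
      field_simp
      ring
  refine equivalent_iff.2 fun q p q' p' => ?_
  simp only [hE]
  exact coe_mul_lt_coe_mul_iff (by positivity)

theorem bdpClass_subset_fdpClass (hΓ : ∀ γ ∈ Γ, 0 ≤ γ) : bdpClass n Γ ⊆ fdpClass n Γ := by
  rintro d ⟨γ, hγΓ, l₁, l₂, h₁, h₂, h₁₂, hE⟩
  rcases (hΓ γ hγΓ).eq_or_lt with rfl | hγ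
  · refine ⟨0, hγΓ, _, isFDPGenerator_coe, fun _ => by simp, Equivalent.trans ?_ hE⟩
    refine equivalent_iff.2 fun q p q' p' => ?_
    rw [bdpCE_zero_lt_iff h₁₂]
    simp [fdpCE]
  · rcases h₂.eq_or_lt with rfl | h₂
    · refine ⟨γ, hγΓ, _, isFDPGenerator_coe, fun h => absurd h hγ.ne', Equivalent.trans ?_ hE⟩
      exact equivalent_fdpCE_bdpCE_affine (a := 1) (b := 0) hγ hγΓ one_pos (by linarith) (by simp)
    · refine ⟨γ, hγΓ, _, isFDPGenerator_elog h₁ h₂, fun h => absurd h hγ.ne',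
        Equivalent.trans ?_ hE⟩
      exact equivalent_fdpCE_bdpCE_log (a := 1) (b := 0) hγ hγΓ one_pos h₁ h₂ (by simp)

/-! ### Bridge cross-entropies as norm-based Bregman cross-entropies -/

/-- A generator that does not depend on the exponent. -/
theorem isNBGenerator_const {f : ℝ → ℝ} (hm : StrictMonoOn f (Ici 0)) (hc : ConvexOn ℝ (Ici 0) f)
    (hd : ∀ z, 0 < z → DifferentiableAt ℝ f z) : IsNBGenerator fun _ => f :=
  ⟨fun _ _ => hm, fun _ _ => hc, fun _ _ => hd, differentiableWithinAt_const _⟩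

theorem isNBGenerator_rpow {r : ℝ} (hr : 1 < r) : IsNBGenerator fun _ z => z ^ r :=
  isNBGenerator_const (Real.strictMonoOn_rpow_Ici_of_exponent_pos (by linarith))
    (convexOn_rpow hr.le) fun _ hz => (Real.hasDerivAt_rpow_const (Or.inl hz.ne')).differentiableAt

/-- The generator of the bridge divergence in the norm-based Bregman class. -/
def bridgeGen (l₁ l₂ r z : ℝ) : ℝ := (l₁ + l₂ * z ^ r) ^ (1 / r)

theorem hasDerivAt_bridgeGen {l₁ l₂ r z : ℝ} (h₁ : 0 ≤ l₁) (h₂ : 0 < l₂) (hr : 1 < r)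
    (hz : 0 < z) : HasDerivAt (bridgeGen l₁ l₂ r)
      (l₂ * z ^ (r - 1) * (l₁ + l₂ * z ^ r) ^ (1 / r - 1)) z := by
  have hL : 0 < l₁ + l₂ * z ^ r := by positivity
  have h := (((Real.hasDerivAt_rpow_const (p := r) (Or.inl hz.ne')).const_mul l₂).const_add
    l₁).rpow_const (p := 1 / r) (Or.inl hL.ne')
  refine h.congr_deriv ?_
  have : r ≠ 0 := by linarith
  field_simp

/-- The derivative is `l₂` times a nonnegative power of `z ^ r / (l₁ + l₂ * z ^ r)`, which is
nondecreasing in `z`. -/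
theorem isNBGenerator_bridgeGen {l₁ l₂ r : ℝ} (h₁ : 0 ≤ l₁) (h₂ : 0 < l₂) (hr : 1 < r) :
    IsNBGenerator fun _ => bridgeGen l₁ l₂ r := by
  have hr0 : 0 < r := by linarith
  refine isNBGenerator_const ?_ ?_ fun z hz =>
    (hasDerivAt_bridgeGen h₁ h₂ hr hz).differentiableAt
  · intro x hx y hy hxy
    have hx : 0 ≤ x := hx
    refine Real.rpow_lt_rpow (by positivity) ?_ (by positivity)
    have := mul_lt_mul_of_pos_left (Real.rpow_lt_rpow hx hxy hr0) h₂
    linarith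
  · refine MonotoneOn.convexOn_of_deriv (convex_Ici 0) ?_ ?_ ?_
    · have hc : Continuous (bridgeGen l₁ l₂ r) := by
        unfold bridgeGen
        refine Continuous.rpow_const ?_ fun _ => Or.inr (by positivity)
        exact continuous_const.add (continuous_const.mul
          (Real.continuous_rpow_const hr0.le))
      exact hc.continuousOn
    · intro z hz
      rw [interior_Ici] at hz
      exact (hasDerivAt_bridgeGen h₁ h₂ hr hz).differentiableAt.differentiableWithinAt
    · rw [interior_Ici]
      have hform : ∀ z, 0 < z → deriv (bridgeGen l₁ l₂ r) z =
          l₂ * (z ^ r / (l₁ + l₂ * z ^ r)) ^ (1 - 1 / r) := by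
        intro z hz
        have hL : 0 < l₁ + l₂ * z ^ r := by positivity
        rw [(hasDerivAt_bridgeGen h₁ h₂ hr hz).deriv, Real.div_rpow (by positivity) hL.le,
          ← Real.rpow_mul hz.le, mul_assoc,
          show 1 / r - 1 = -(1 - 1 / r) by ring, Real.rpow_neg hL.le, ← div_eq_mul_inv,
          show r * (1 - 1 / r) = r - 1 by field_simp]
      intro x hx y hy hxy
      have hx : 0 < x := hx
      have hy : 0 < y := hy
      rw [hform x hx, hform y hy]
      refine mul_le_mul_of_nonneg_left (Real.rpow_le_rpow (by positivity) ?_ ?_) h₂.le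
      · rw [div_le_div_iff₀ (by positivity) (by positivity)]
        have := mul_le_mul_of_nonneg_left (Real.rpow_le_rpow hx.le hxy hr0.le) h₁
        linarith
      · rw [sub_nonneg, div_le_one hr0]
        exact hr.le

theorem nbCE_rpow_eq {γ : ℝ} (hγΓ : γ ∈ Γ) (hγ : 0 < γ) (q p : densities n Γ) :
    nbCE (fun _ z => z ^ (1 + γ)) γ q.1 p.1 = ((dpCE γ q.1 p.1 : ℝ) : EReal) := by
  have hy := power_pos hγΓ hγ.le p
  have hN : 0 < power γ p.1 ^ (1 / (1 + γ)) := Real.rpow_pos_of_pos hy _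
  have hNr : (power γ p.1 ^ (1 / (1 + γ))) ^ (1 + γ) = power γ p.1 := by
    rw [← Real.rpow_mul hy.le, one_div_mul_cancel (by positivity), Real.rpow_one]
  rw [nbCE, if_neg hγ.ne', powerNorm, (Real.hasDerivAt_rpow_const (Or.inl hN.ne')).deriv, hNr,
    add_sub_cancel_left, Real.one_rpow, dpCE]
  have hNγ : 0 < (power γ p.1 ^ (1 / (1 + γ))) ^ γ := Real.rpow_pos_of_pos hN _
  congr 1
  field_simp
  ring

/-- With `r = 1 + γ` the factor `N ^ γ` of the derivative at the norm `N` cancels, and the terms in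
the power integral combine into a single product. -/
theorem nbCE_bridgeGen_eq {γ l₁ l₂ : ℝ} (hγΓ : γ ∈ Γ) (hγ : 0 < γ) (h₁ : 0 ≤ l₁) (h₂ : 0 < l₂)
    (q p : densities n Γ) :
    nbCE (fun _ => bridgeGen l₁ l₂ (1 + γ)) γ q.1 p.1 =
      ((-((l₁ + l₂ * power γ p.1) ^ (1 / (1 + γ) - 1) * (l₁ + l₂ * cross γ q.1 p.1)) / γ +
        bridgeGen l₁ l₂ (1 + γ) 1 / γ : ℝ) : EReal) := by
  have hy := power_pos hγΓ hγ.le p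
  have hN : 0 < power γ p.1 ^ (1 / (1 + γ)) := Real.rpow_pos_of_pos hy _
  have hNr : (power γ p.1 ^ (1 / (1 + γ))) ^ (1 + γ) = power γ p.1 := by
    rw [← Real.rpow_mul hy.le, one_div_mul_cancel (by positivity), Real.rpow_one]
  have hNγ : 0 < (power γ p.1 ^ (1 / (1 + γ))) ^ γ := Real.rpow_pos_of_pos hN _
  have hL : 0 < l₁ + l₂ * power γ p.1 := by positivity
  have hval : bridgeGen l₁ l₂ (1 + γ) (power γ p.1 ^ (1 / (1 + γ))) =
      (l₁ + l₂ * power γ p.1) ^ (1 / (1 + γ) - 1) * (l₁ + l₂ * power γ p.1) := by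
    rw [bridgeGen, hNr, Real.rpow_sub_one hL.ne', div_mul_cancel₀ _ hL.ne']
  rw [nbCE, if_neg hγ.ne', powerNorm,
    (hasDerivAt_bridgeGen h₁ h₂ (by linarith) hN).deriv, hNr, hval, add_sub_cancel_left]
  congr 1
  generalize (l₁ + l₂ * power γ p.1) ^ (1 / (1 + γ) - 1) = K
  field_simp
  ring

theorem bdpClass_subset_nbClass (hΓ : ∀ γ ∈ Γ, 0 ≤ γ) : bdpClass n Γ ⊆ nbClass n Γ := by
  rintro d ⟨γ, hγΓ, l₁, l₂, h₁, h₂, h₁₂, hE⟩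
  rcases (hΓ γ hγΓ).eq_or_lt with rfl | hγ
  · refine ⟨0, hγΓ, _, isNBGenerator_rpow one_lt_two, Equivalent.trans ?_ hE⟩
    refine equivalent_iff.2 fun q p q' p' => ?_
    rw [bdpCE_zero_lt_iff h₁₂, nbCE_zero_lt_iff (isNBGenerator_rpow one_lt_two)]
  · rcases h₂.eq_or_lt with rfl | h₂
    · refine ⟨γ, hγΓ, _, isNBGenerator_rpow (r := 1 + γ) (by linarith), Equivalent.trans ?_ hE⟩
      refine equivalent_iff.2 fun q p q' p' => ?_
      have hl : 0 < 1 / l₁ := by rw [add_zero] at h₁₂; positivity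
      simp only [nbCE_rpow_eq hγΓ hγ, bdpCE, hγ.ne', if_false, if_true, EReal.coe_lt_coe_iff]
      rw [mul_lt_mul_iff_right₀ hl]
    · refine ⟨γ, hγΓ, _, isNBGenerator_bridgeGen (r := 1 + γ) h₁ h₂ (by linarith),
        Equivalent.trans ?_ hE⟩
      refine equivalent_iff.2 fun q p q' p' => ?_
      simp only [nbCE_bridgeGen_eq hγΓ hγ h₁ h₂, EReal.coe_lt_coe_iff]
      set F : densities n Γ → densities n Γ → ℝ := fun q p =>
        (l₁ + l₂ * power γ p.1) ^ (1 / (1 + γ) - 1) * (l₁ + l₂ * cross γ q.1 p.1) with hF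
      have hL : ∀ p : densities n Γ, 0 < l₁ + l₂ * power γ p.1 := fun p => by
        have := mul_pos h₂ (power_pos hγΓ hγ.le p)
        linarith
      have hM : ∀ q p : densities n Γ, 0 ≤ l₁ + l₂ * cross γ q.1 p.1 := fun q p => by
        have := mul_nonneg h₂.le (cross_nonneg γ q p)
        linarith
      have hpos : ∀ q p, 0 < l₁ + l₂ * cross γ q.1 p.1 → 0 < F q p := fun q p h =>
        mul_pos (Real.rpow_pos_of_pos (hL p) _) h
      -- The exponent `1 / (1 + γ) - 1 = -γ / (1 + γ)` turns the factor `(1 + γ) / (l₂ * γ)` into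
      -- the coefficient `1 / l₂` of the power term. The remaining case `F q p = 0` matches the
      -- value `⊤`.
      have hb : ∀ q p, 0 < l₁ + l₂ * cross γ q.1 p.1 → bdpCE l₁ l₂ γ q.1 p.1 =
          ((-((1 + γ) / (l₂ * γ) * Real.log (F q p)) +
            1 / (l₂ * γ) * Real.log (l₁ + l₂) : ℝ) : EReal) := by
        intro q p h
        rw [bdpCE_eq_coe hγΓ hγ h₁ h₂ h, hF]
        simp only
        rw [Real.log_mul (Real.rpow_pos_of_pos (hL p) _).ne' h.ne', Real.log_rpow (hL p)]
        congr 1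
        field_simp
        ring
      have hleft : -F q p / γ + bridgeGen l₁ l₂ (1 + γ) 1 / γ <
          -F q' p' / γ + bridgeGen l₁ l₂ (1 + γ) 1 / γ ↔ F q' p' < F q p := by
        rw [add_lt_add_iff_right, div_lt_div_iff_of_pos_right hγ, neg_lt_neg_iff]
      refine hleft.trans ?_
      rcases (hM q p).eq_or_lt with h0 | h0
      · rw [bdpCE_eq_top hγΓ hγ h₁ h₂ h0.symm]
        have : F q p = 0 := by simp only [hF, ← h0, mul_zero]
        rw [this]
        simp only [not_top_lt, iff_false, not_lt]
        exact mul_nonneg (Real.rpow_nonneg (hL p').le _) (hM q' p')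
      · rcases (hM q' p').eq_or_lt with h0' | h0'
        · rw [bdpCE_eq_top hγΓ hγ h₁ h₂ h0'.symm, hb q p h0]
          have : F q' p' = 0 := by simp only [hF, ← h0', mul_zero]
          simp only [this, hpos q p h0, EReal.coe_lt_top]
        · have hκ : 0 < (1 + γ) / (l₂ * γ) := by positivity
          rw [hb q p h0, hb q' p' h0', EReal.coe_lt_coe_iff, add_lt_add_iff_right, neg_lt_neg_iff,
            mul_lt_mul_iff_right₀ hκ, Real.log_lt_log_iff (hpos q' p' h0') (hpos q p h0)]

/-! ### The intersection of the two classes -/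

theorem fdpCE_mem_bdpClass {γ : ℝ} (hγΓ : γ ∈ Γ) (hγ : 0 < γ) {v : ℝ → EReal}
    (h : (∃ a b : ℝ, 0 < a ∧ ∀ z : ℝ, 0 ≤ z → v z = ((a * z + b : ℝ) : EReal)) ∨
      ∃ a b l₁ l₂ : ℝ, 0 < a ∧ 0 ≤ l₁ ∧ 0 < l₂ ∧
        ∀ z : ℝ, 0 ≤ z → v z = (a : EReal) * elog (l₁ + l₂ * z) + (b : EReal)) :
    (fun q p => fdpCE v γ q.1 p.1) ∈ bdpClass n Γ := by
  rcases h with ⟨a, b, ha, hv⟩ | ⟨a, b, l₁, l₂, ha, h₁, h₂, hv⟩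
  · exact ⟨γ, hγΓ, 1, 0, zero_le_one, le_rfl, by norm_num,
      (equivalent_fdpCE_bdpCE_affine hγ hγΓ ha one_pos hv).symm⟩
  · exact ⟨γ, hγΓ, l₁, l₂, h₁, h₂.le, by linarith,
      (equivalent_fdpCE_bdpCE_log hγ hγΓ ha h₁ h₂ hv).symm⟩

theorem nbClass_inter_fdpClass_subset (hn : 0 < n) (hΓ : ∀ γ ∈ Γ, 0 ≤ γ) :
    nbClass n Γ ∩ fdpClass n Γ ⊆ bdpClass n Γ := by
  rintro d ⟨⟨γ', hγ'Γ, φ, hφ, hE'⟩, γ, hγΓ, v, hv, -, hE⟩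
  rcases (hΓ γ hγΓ).eq_or_lt with rfl | hγ
  · rcases (hΓ γ' hγ'Γ).eq_or_lt with rfl | hγ'
    · refine ⟨0, hγΓ, 1, 0, zero_le_one, le_rfl, by norm_num, Equivalent.trans ?_ hE'⟩
      refine equivalent_iff.2 fun q p q' p' => ?_
      rw [bdpCE_zero_lt_iff (by norm_num), nbCE_zero_lt_iff hφ]
    · obtain ⟨q, q', p, hs, hne⟩ := exists_shannon_eq_nbCE_ne hn hΓ hγ'Γ hγ' hφ
      refine absurd (((hE.trans hE'.symm).eq_iff_eq q p q' p).1 ?_) hne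
      simp only [fdpCE, if_true, hs]
  · have hv' := generator_of_mem_nbClass hn hΓ hγΓ hγ hv
      ⟨γ', hγ'Γ, φ, hφ, hE'.trans hE.symm⟩
    obtain ⟨γ₀, hγ₀, l₁, l₂, h₁, h₂, h₁₂, hE₀⟩ := fdpCE_mem_bdpClass (n := n) hγΓ hγ hv'
    exact ⟨γ₀, hγ₀, l₁, l₂, h₁, h₂, h₁₂, hE₀.trans hE⟩

end classes

end PowerDivergence

end

theorem theorem2 (n : ℕ) (hn : 0 < n) (Γ : Set ℝ) (hΓ : ∀ γ ∈ Γ, 0 ≤ γ)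
    (hpos : ∃ γ ∈ Γ, 0 < γ) :
    PowerDivergence.nbClass n Γ ∩ PowerDivergence.fdpClass n Γ = PowerDivergence.bdpClass n Γ ∧
    ∀ γ ∈ Γ, 0 < γ → ∀ v : ℝ → EReal, PowerDivergence.IsFDPGenerator v →
      ((fun q p => PowerDivergence.fdpCE v γ q.1 p.1) ∈ PowerDivergence.nbClass n Γ ↔
        (∃ a b : ℝ, 0 < a ∧ ∀ z : ℝ, 0 ≤ z → v z = ((a * z + b : ℝ) : EReal)) ∨
        ∃ a b l₁ l₂ : ℝ, 0 < a ∧ 0 ≤ l₁ ∧ 0 < l₂ ∧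
          ∀ z : ℝ, 0 ≤ z →
            v z = (a : EReal) * PowerDivergence.elog (l₁ + l₂ * z) + (b : EReal)) := by
  open PowerDivergence in
  refine ⟨Subset.antisymm (nbClass_inter_fdpClass_subset hn hΓ) fun d hd =>
    ⟨bdpClass_subset_nbClass hΓ hd, bdpClass_subset_fdpClass hΓ hd⟩, fun γ hγΓ hγ v hv =>
    ⟨generator_of_mem_nbClass hn hΓ hγΓ hγ hv, fun h =>
      bdpClass_subset_nbClass hΓ (fdpCE_mem_bdpClass hγΓ hγ h)⟩⟩
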